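/- Use cylindrical coordinates $(r,\varphi,z)$ on $\mathbb R^3$ and let $r_0>0$. Let $S=\{(r,\varphi,z): z=\sin(1/r),\ 0<r\le r_0\}$ be the surface obtained by rotating the topologist's sine curve about its limiting arc, and let $L=\{(0,0,z): -1\le z\le 1\}$ be the central limit arc. Let $\alpha_0,\alpha_1,\dots$ be a sequence of arcs in $\mathbb R^3$ (the connecting arcs) such that each $\alpha_n$ lies in a radial cross section (a closed half-plane bounded by the $z$-axis) and has both end points in $S\cup L$, distinct arcs are disjoint outside $S\cup L$, and $\operatorname{diam}\alpha_n\to 0$. Let $$A=S\cup L\cup\bigcup_n \alpha_n .$$ (Arcs are allowed to cross $S$. The arcs may in particular be chosen in a dense set of radial cross sections so that $A$ is locally path connected, but this is not required.) Let $b\colon S^1\to S$ be a loop in the surface of constant radius, i.e. the coordinate $r$ is constant along $b$. If $b$ is freely homotopic in $A$ to a constant loop, then $b$ is nulhomotopic in its own image: it is homotopic to a constant loop, relative to its base point, through loops in $b(S^1)$. -/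

import Mathlib

open Set Filter Topology

noncomputable section

/-- Euclidean three-space. -/
abbrev E3 : Type := EuclideanSpace ℝ (Fin 3)

/-- The point of `E3` with cylindrical coordinates `(r, φ, z)`. -/
def cyl (r φ z : ℝ) : E3 := !₂[r * Real.cos φ, r * Real.sin φ, z]

/-- The cylindrical radius of a point: its distance to the vertical axis. -/
def cylRadius (p : E3) : ℝ := Real.sqrt (p 0 ^ 2 + p 1 ^ 2)

/-- The surface: the curve `z = sin (1 / r)`, `0 < r ≤ r₀`, rotated about the vertical axis. -/
def surface (r₀ : ℝ) : Set E3 :=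
  {p | ∃ r φ : ℝ, 0 < r ∧ r ≤ r₀ ∧ p = cyl r φ (Real.sin (1 / r))}

/-- The central limit arc `{(0, 0, z) : -1 ≤ z ≤ 1}`. -/
def centralArc : Set E3 :=
  {p | ∃ z : ℝ, -1 ≤ z ∧ z ≤ 1 ∧ p = cyl 0 0 z}

/-- The surface together with its central limit arc. -/
def core (r₀ : ℝ) : Set E3 := surface r₀ ∪ centralArc

/-- The closed vertical half-plane at angle `φ`. -/
def radialSection (φ : ℝ) : Set E3 :=
  {p | ∃ r z : ℝ, 0 ≤ r ∧ p = cyl r φ z}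

/-- `α` is a null sequence of connecting arcs, lying in radial cross sections and attached to the
surface and the central limit arc.

The arcs may cross the surface (as horizontal segments issuing from the central arc do), in which
case they are cut by it into smaller arcs, or they may meet it in end points only; outside the
surface and the central arc they are pairwise disjoint.
Nothing is asked about how densely the arcs are distributed: every choice is allowed, in
particular each one that makes the resulting space locally path connected. -/
structure IsConnectingArcs (r₀ : ℝ) (α : ℕ → C(unitInterval, E3)) : Prop where
  /-- each `α n` is an arc -/
  injective : ∀ n, Function.Injective (α n)
  /-- each arc lies in a radial cross section -/
  radial : ∀ n, ∃ φ : ℝ, range (α n) ⊆ radialSection φ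
  /-- each arc starts on the surface or the central arc -/
  source_mem : ∀ n, α n 0 ∈ core r₀
  /-- each arc ends on the surface or the central arc -/
  target_mem : ∀ n, α n 1 ∈ core r₀
  /-- different arcs meet at most on the surface or the central arc -/
  disjoint : ∀ m n, m ≠ n → range (α m) ∩ range (α n) ⊆ core r₀
  /-- the diameters of the arcs tend to zero -/
  null : Tendsto (fun n => Metric.diam (range (α n))) atTop (𝓝 0)

/-- The space `A`: the surface, the central limit arc and the connecting arcs. -/
def spaceA (r₀ : ℝ) (α : ℕ → C(unitInterval, E3)) : Set E3 :=
  core r₀ ∪ ⋃ n, range (α n)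

/-- A loop in `E3` whose image lies in `X`, as a loop in the subspace `X`. -/
def loopIn (b : C(Circle, E3)) (X : Set E3) (h : ∀ t, b t ∈ X) : C(Circle, X) :=
  ⟨fun t => ⟨b t, h t⟩, b.continuous.subtype_mk h⟩

/-- The loop `b` lies in `X` and is freely homotopic, in the subspace `X`, to a constant loop. -/
def FreelyNulhomotopicIn (b : C(Circle, E3)) (X : Set E3) : Prop :=
  ∃ h : ∀ t, b t ∈ X, (loopIn b X h).Nullhomotopic

/-- The loop `b` lies in `X` and is homotopic to the constant loop, in the subspace `X` and
relative to its base point `b 1`. -/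
def NulhomotopicIn (b : C(Circle, E3)) (X : Set E3) : Prop :=
  ∃ h : ∀ t, b t ∈ X,
    (loopIn b X h).HomotopicRel (ContinuousMap.const Circle (loopIn b X h 1)) {1}

end

/-! A null homotopy of `b` is a map `H` from the plane to `A` that outside the unit disc is `b`
after radial projection. Each connecting arc stays in one half-plane, so the angular coordinate
extends to a circle-valued `Θ` on `A` minus the central arc (`IsConnectingArcs.exists_angle`). If
`H` missed the central arc, lifting `Θ ∘ H` to the reals would give `b` a real-valued angle, and
shrinking that angle linearly within its interval of values would contract `b` in its image.

In general `H` meets the central arc. By `IsConnectingArcs.exists_separating_preimage` there is a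
finite set `F` of points off the core such that the component `W` of the complement of `H ⁻¹' F`
that contains the unit circle has closure missing the preimage of the central arc. On the frontier
of `W` the map `H` has values in `F`, so `Θ ∘ H` has a continuous real argument there; Tietze
extends it, and the lifting argument survives (`exists_circle_extension`).

If no such `F` existed, the closures of these components, cut down to the disc, would intersect in a
continuum containing a point `x` over the central arc that is a limit of points `y` of the continuum
not over it. Near `H x`, finitely many points of arcs separate `H x` from `H y`
(`IsConnectingArcs.exists_local_cut`): oscillation of the sine curve provides small cylinders on
which the core stays away from `H x`, and only finitely many arcs of a null sequence reach such a
place. Pulling back to the plane contradicts Janiszewski's theorem (`not_separated_union`). -/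

/-! ### Separation in the plane by lifting circle-valued maps. -/

/-- Every circle-valued map on the plane has a continuous real argument. -/
theorem exists_circle_lift (f : C(ℂ, Circle)) : ∃ h : C(ℂ, ℝ), ∀ z, Circle.exp (h z) = f z := by
  obtain ⟨e, he⟩ := Circle.exp_surjective (f 0)
  obtain ⟨h, ⟨-, hh⟩, -⟩ :=
    Circle.isCoveringMap_exp.existsUnique_continuousMap_lifts f 0 e he
  exact ⟨h, fun z => congrFun hh z⟩

/-- A function avoiding the value `c` on a preconnected set stays below `c` if it is so at one
point. -/
theorem IsPreconnected.lt_of_forall_ne {Y : Set ℂ} (hY : IsPreconnected Y) {h : ℂ → ℝ}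
    (hh : Continuous h) {c : ℝ} (hc : ∀ z ∈ Y, h z ≠ c) {x y : ℂ} (hx : x ∈ Y) (hy : y ∈ Y)
    (hxc : h x < c) : h y < c := by
  by_contra hcon
  obtain ⟨z, hz, hzc⟩ := hY.intermediate_value hx hy hh.continuousOn ⟨hxc.le, not_lt.1 hcon⟩
  exact hc z hz hzc

theorem circle_exp_re (t : ℝ) : (Circle.exp t : ℂ).re = Real.cos t := by
  rw [Circle.coe_exp, Complex.exp_ofReal_mul_I_re]

theorem circle_exp_im (t : ℝ) : (Circle.exp t : ℂ).im = Real.sin t := by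
  rw [Circle.coe_exp, Complex.exp_ofReal_mul_I_im]

/-- Disjoint closed sets in a metric space are the exact level sets `0` and `1` of a continuous
function with values in the unit interval. -/
theorem exists_continuous_exact_zero_one {X : Type*} [MetricSpace X] {C₁ C₂ : Set X}
    (hC₁ : IsClosed C₁) (hC₂ : IsClosed C₂) (hC : Disjoint C₁ C₂) :
    ∃ g : C(X, ℝ), (∀ z, g z = 0 ↔ z ∈ C₁) ∧ (∀ z, g z = 1 ↔ z ∈ C₂) ∧
      ∀ z, 0 ≤ g z ∧ g z ≤ 1 := by
  have hex : ∀ C : Set X, IsClosed C → ∃ g : C(X, ℝ), (∀ z, g z = 0 ↔ z ∈ C) ∧ ∀ z, 0 ≤ g z := by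
    intro C hC
    rcases C.eq_empty_or_nonempty with rfl | hne
    · exact ⟨⟨fun _ => 1, continuous_const⟩, by simp, by simp⟩
    · exact ⟨⟨fun z => Metric.infDist z C, Metric.continuous_infDist_pt C⟩,
        fun z => (hC.mem_iff_infDist_zero hne).symm, fun z => Metric.infDist_nonneg⟩
  obtain ⟨a, ha, ha0⟩ := hex C₁ hC₁
  obtain ⟨b, hb, hb0⟩ := hex C₂ hC₂
  have hpos : ∀ z, 0 < a z + b z := by
    intro z
    rcases (ha0 z).lt_or_eq with h | h
    · linarith [hb0 z]
    · rcases (hb0 z).lt_or_eq with h' | h'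
      · linarith
      · exact (hC.le_bot ⟨(ha z).1 h.symm, (hb z).1 h'.symm⟩).elim
  refine ⟨⟨fun z => a z / (a z + b z), by
    exact a.continuous.div (a.continuous.add b.continuous) fun z => (hpos z).ne'⟩, ?_, ?_, ?_⟩
  · intro z
    simp only [ContinuousMap.coe_mk, div_eq_zero_iff, (hpos z).ne', or_false, ha]
  · intro z
    simp only [ContinuousMap.coe_mk, div_eq_one_iff_eq (hpos z).ne', ← hb]
    constructor <;> intro h <;> linarith
  · intro z
    exact ⟨div_nonneg (ha0 z) (hpos z).le, (div_le_one (hpos z)).2 (by linarith [hb0 z])⟩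

/-- Janiszewski's theorem for disjoint closed sets: if neither of them separates `x` from `y` in
the plane, then neither does their union. -/
theorem not_separated_union {C₁ C₂ U V Y₁ Y₂ : Set ℂ} (hC₁ : IsClosed C₁) (hC₂ : IsClosed C₂)
    (hC : Disjoint C₁ C₂) (hU : IsOpen U) (hV : IsOpen V)
    (hUV : ∀ z ∈ U, z ∈ V → z ∈ C₁ ∪ C₂) (hcov : (C₁ ∪ C₂)ᶜ ⊆ U ∪ V)
    (hY₁ : IsPreconnected Y₁) (hY₂ : IsPreconnected Y₂) (h₁ : Disjoint Y₁ C₁)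
    (h₂ : Disjoint Y₂ C₂) {x y : ℂ} (hx₁ : x ∈ Y₁) (hx₂ : x ∈ Y₂) (hy₁ : y ∈ Y₁) (hy₂ : y ∈ Y₂)
    (hxU : x ∈ U) (hyV : y ∈ V) : False := by
  classical
  have hxC₁ : x ∉ C₁ := fun h => h₁.le_bot ⟨hx₁, h⟩
  have hxC₂ : x ∉ C₂ := fun h => h₂.le_bot ⟨hx₂, h⟩
  have hyC₁ : y ∉ C₁ := fun h => h₁.le_bot ⟨hy₁, h⟩
  have hyC₂ : y ∉ C₂ := fun h => h₂.le_bot ⟨hy₂, h⟩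
  obtain ⟨g, hg0, hg1, hg⟩ := exists_continuous_exact_zero_one hC₁ hC₂ hC
  have hgx : 0 < g x ∧ g x < 1 := ⟨lt_of_le_of_ne (hg x).1 fun h => hxC₁ ((hg0 x).1 h.symm),
    lt_of_le_of_ne (hg x).2 fun h => hxC₂ ((hg1 x).1 h)⟩
  have hgy : 0 < g y ∧ g y < 1 := ⟨lt_of_le_of_ne (hg y).1 fun h => hyC₁ ((hg0 y).1 h.symm),
    lt_of_le_of_ne (hg y).2 fun h => hyC₂ ((hg1 y).1 h)⟩
  have hyU : y ∉ U := fun h => (hUV y h hyV).elim hyC₁ hyC₂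
  -- The two branches agree on `C₁`, where `g = 0`, and on `C₂`, where `g = 1` and `π`, `-π` are the
  -- same angle.
  let f : ℂ → Circle := fun z =>
    if z ∈ U ∧ z ∉ C₁ ∪ C₂ then Circle.exp (Real.pi * g z) else Circle.exp (-(Real.pi * g z))
  have hf : Continuous f := by
    have hA₁ : IsClosed (V \ (C₁ ∪ C₂))ᶜ := (hV.sdiff (hC₁.union hC₂)).isClosed_compl
    have hA₂ : IsClosed (U \ (C₁ ∪ C₂))ᶜ := (hU.sdiff (hC₁.union hC₂)).isClosed_compl
    have hun : (V \ (C₁ ∪ C₂))ᶜ ∪ (U \ (C₁ ∪ C₂))ᶜ = univ := by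
      ext z
      have := hUV z
      simp only [mem_union, mem_compl_iff, Set.mem_sdiff, mem_univ, iff_true] at this ⊢
      tauto
    rw [← continuousOn_univ, ← hun]
    refine ContinuousOn.union_of_isClosed ?_ ?_ hA₁ hA₂
    · refine ContinuousOn.congr (f := fun z => Circle.exp (Real.pi * g z)) (by fun_prop) ?_
      intro z hz
      by_cases hzU : z ∈ U ∧ z ∉ C₁ ∪ C₂
      · simp only [f, if_pos hzU]
      · have hzC : z ∈ C₁ ∪ C₂ := by
          have := @hcov z
          simp only [mem_union, mem_compl_iff, Set.mem_sdiff] at this hz hzU ⊢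
          tauto
        simp only [f, if_neg hzU]
        rcases hzC with h | h
        · simp [(hg0 z).2 h]
        · rw [(hg1 z).2 h, Circle.exp_eq_exp]
          exact ⟨-1, by push_cast; ring⟩
    · refine ContinuousOn.congr (f := fun z => Circle.exp (-(Real.pi * g z))) (by fun_prop) ?_
      intro z hz
      exact if_neg hz
  have hfre : ∀ z, (f z : ℂ).re = Real.cos (Real.pi * g z) := by
    intro z
    by_cases hz : z ∈ U ∧ z ∉ C₁ ∪ C₂
    · simp only [f, if_pos hz, circle_exp_re]
    · simp only [f, if_neg hz, circle_exp_re, Real.cos_neg]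
  obtain ⟨h, hh⟩ := exists_circle_lift ⟨f, hf⟩
  have hcos : ∀ z, Real.cos (h z) = Real.cos (Real.pi * g z) := fun z => by
    rw [← hfre z, ← circle_exp_re, hh z]; rfl
  obtain ⟨n, hn⟩ : ∃ n : ℤ, h x = Real.pi * g x + n * (2 * Real.pi) := by
    refine Circle.exp_eq_exp.1 ((hh x).trans ?_)
    exact if_pos ⟨hxU, fun h => h.elim hxC₁ hxC₂⟩
  have hπ := Real.pi_pos
  have hc₁ : ∀ z ∈ Y₁, ∀ m : ℤ, h z ≠ m * (2 * Real.pi) := by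
    intro z hz m hm
    have h1 : Real.cos (Real.pi * g z) = 1 := by rw [← hcos, hm, Real.cos_int_mul_two_pi]
    have := (Real.cos_eq_one_iff_of_lt_of_lt (by nlinarith [(hg z).1]) (by nlinarith [(hg z).2])).1 h1
    have h0 : g z = 0 := by simpa [hπ.ne'] using this
    exact h₁.le_bot ⟨hz, (hg0 z).1 h0⟩
  have hc₂ : ∀ z ∈ Y₂, ∀ m : ℤ, h z ≠ Real.pi + m * (2 * Real.pi) := by
    intro z hz m hm
    have h1 : Real.cos (Real.pi * g z) = -1 := by
      rw [← hcos, hm, Real.cos_add_int_mul_two_pi, Real.cos_pi]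
    have h2 : Real.cos (Real.pi - Real.pi * g z) = 1 := by rw [Real.cos_pi_sub, h1, neg_neg]
    have := (Real.cos_eq_one_iff_of_lt_of_lt (by nlinarith [(hg z).2]) (by nlinarith [(hg z).1])).1 h2
    have h3 : g z = 1 := by
      have : Real.pi * (1 - g z) = 0 := by linarith
      rcases mul_eq_zero.1 this with h | h
      · exact absurd h hπ.ne'
      · linarith
    exact h₂.le_bot ⟨hz, (hg1 z).1 h3⟩
  -- The lift cannot cross `2πn` along `Y₁` nor `π + 2πn` along `Y₂`, so `sin (h y) > 0`; but `y`
  -- lies in the branch with angle `-π g y`, whose sine is negative.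
  have hlow : (n : ℝ) * (2 * Real.pi) < h y := by
    by_contra hcon
    have hne := hc₁ y hy₁ n
    have := hY₁.lt_of_forall_ne h.continuous (fun z hz => hc₁ z hz n) hy₁ hx₁
      (lt_of_le_of_ne (not_lt.1 hcon) hne)
    nlinarith
  have hup : h y < Real.pi + n * (2 * Real.pi) :=
    hY₂.lt_of_forall_ne h.continuous (fun z hz => hc₂ z hz n) hx₂ hy₂ (by nlinarith)
  have hs1 : 0 < Real.sin (h y) := by
    rw [← Real.sin_sub_int_mul_two_pi (h y) n]
    exact Real.sin_pos_of_pos_of_lt_pi (by linarith) (by linarith)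
  have hs2 : Real.sin (h y) = - Real.sin (Real.pi * g y) := by
    rw [← circle_exp_im, hh y]
    change ((f y : Circle) : ℂ).im = _
    simp only [f, if_neg (fun h : y ∈ U ∧ y ∉ C₁ ∪ C₂ => hyU h.1), circle_exp_im, Real.sin_neg]
  have hs3 : 0 < Real.sin (Real.pi * g y) :=
    Real.sin_pos_of_pos_of_lt_pi (by nlinarith) (by nlinarith)
  linarith

/-! ### Continua and components. -/

/-- The intersection of a directed family of compact preconnected sets is preconnected. -/
theorem isPreconnected_iInter_of_directed {X ι : Type*} [TopologicalSpace X] [T2Space X]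
    [Nonempty ι] {M : ι → Set X} (hdir : Directed (· ⊇ ·) M) (hc : ∀ i, IsCompact (M i))
    (hp : ∀ i, IsPreconnected (M i)) : IsPreconnected (⋂ i, M i) := by
  have hEc : IsCompact (⋂ i, M i) := (hc (Classical.arbitrary ι)).of_isClosed_subset
    (isClosed_iInter fun i => (hc i).isClosed) (iInter_subset _ _)
  rw [isPreconnected_closed_iff]
  intro A B hA hB hcov hEA hEB
  by_contra hne
  rw [not_nonempty_iff_eq_empty] at hne
  obtain ⟨U, V, hU, hV, hAU, hBV, hUV⟩ := SeparatedNhds.of_isCompact_isCompact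
    (hEc.inter_right hA) (hEc.inter_right hB) (by
      rw [disjoint_iff_inter_eq_empty, ← hne]; ext; simp; tauto)
  obtain ⟨i, hi⟩ := exists_subset_nhds_of_isCompact (V := M) hdir hc (U := U ∪ V) (by
    intro x hx
    refine (hU.union hV).mem_nhds ?_
    exact (hcov hx).imp (fun h => hAU ⟨hx, h⟩) (fun h => hBV ⟨hx, h⟩))
  obtain ⟨a, ha, haA⟩ := hEA
  obtain ⟨c, hc, hcB⟩ := hEB
  obtain ⟨z, -, hzU, hzV⟩ := hp i U V hU hV hi ⟨a, mem_iInter.1 ha i, hAU ⟨ha, haA⟩⟩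
    ⟨c, mem_iInter.1 hc i, hBV ⟨hc, hcB⟩⟩
  exact hUV.le_bot ⟨hzU, hzV⟩

/-- A directed intersection of continua that all meet the closed set `K`, and that does not lie
in `K`, has a point of `K` that is approached from outside `K`. -/
theorem exists_mem_closure_diff_of_directed {X ι : Type*} [TopologicalSpace X] [T2Space X]
    [Nonempty ι] {M : ι → Set X} (hdir : Directed (· ⊇ ·) M) (hc : ∀ i, IsCompact (M i))
    (hp : ∀ i, IsPreconnected (M i)) {K : Set X} (hK : IsClosed K) (hMK : ∀ i, (M i ∩ K).Nonempty)
    {a : X} (ha : ∀ i, a ∈ M i) (haK : a ∉ K) :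
    ∃ x ∈ K, (∀ i, x ∈ M i) ∧ x ∈ closure ((⋂ i, M i) \ K) := by
  obtain ⟨k, hk⟩ := IsCompact.nonempty_iInter_of_directed_nonempty_isCompact_isClosed
    (fun i => M i ∩ K) (fun i j => by
      obtain ⟨l, h1, h2⟩ := hdir i j
      exact ⟨l, inter_subset_inter_left _ h1, inter_subset_inter_left _ h2⟩)
    hMK (fun i => (hc i).inter_right hK) (fun i => (hc i).isClosed.inter hK)
  rw [mem_iInter] at hk
  -- The connected intersection is covered by the closed sets `K` and the closure of its part off
  -- `K`; it meets both, so they share a point of it.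
  obtain ⟨x, hxE, hxK, hxc⟩ := isPreconnected_closed_iff.1
    (isPreconnected_iInter_of_directed hdir hc hp) K (closure ((⋂ i, M i) \ K)) hK isClosed_closure
    (fun z hz => by
      by_cases hzK : z ∈ K
      · exact Or.inl hzK
      · exact Or.inr (subset_closure ⟨hz, hzK⟩))
    ⟨k, mem_iInter.2 fun i => (hk i).1, (hk (Classical.arbitrary ι)).2⟩
    ⟨a, mem_iInter.2 ha, subset_closure ⟨mem_iInter.2 ha, haK⟩⟩
  exact ⟨x, hxK, mem_iInter.1 hxE, hxc⟩

/-- The frontier of a component of an open set in a locally connected space avoids the set. -/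
theorem closure_connectedComponentIn_inter {X : Type*} [TopologicalSpace X]
    [LocallyConnectedSpace X] {O : Set X} (hO : IsOpen O) {a z : X}
    (hz : z ∈ closure (connectedComponentIn O a)) (hzO : z ∈ O) :
    z ∈ connectedComponentIn O a := by
  obtain ⟨w, hw, hwa⟩ := mem_closure_iff.1 hz _ hO.connectedComponentIn
    (mem_connectedComponentIn hzO)
  have h1 := connectedComponentIn_eq hw
  have h2 := connectedComponentIn_eq hwa
  rw [h2, ← h1]
  exact mem_connectedComponentIn hzO

/-! ### Extending circle-valued maps and loops over the plane. -/

/-- A circle-valued map on the closure of an open set that factors over a finite set on the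
frontier extends continuously. -/
theorem exists_circle_extension {Y : Type*} [TopologicalSpace Y] [T1Space Y] {W : Set ℂ}
    {φ : ℂ → Y} (hφ : Continuous φ) {F : Set Y} (hF : F.Finite)
    (hfr : ∀ z ∈ closure W, z ∉ W → φ z ∈ F)
    (Θ : Y → Circle) (hΘ : ContinuousOn (fun z => Θ (φ z)) (closure W)) (hW : IsOpen W) :
    ∃ g : C(ℂ, Circle), ∀ z ∈ closure W, g z = Θ (φ z) := by
  classical
  choose τ hτ using Circle.exp_surjective
  -- An arbitrary choice of arguments is continuous here because the finite set `F` is discrete.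
  have hcont : ContinuousOn (fun z => τ (Θ (φ z))) (φ ⁻¹' F) :=
    (hF.continuousOn fun v => τ (Θ v)).comp hφ.continuousOn (mapsTo_preimage _ _)
  obtain ⟨ψ, hψ⟩ := ContinuousMap.exists_restrict_eq (hF.isClosed.preimage hφ)
    ⟨_, continuousOn_iff_continuous_domRestrict.1 hcont⟩
  have hψ' : ∀ z, φ z ∈ F → Circle.exp (ψ z) = Θ (φ z) := by
    intro z hz
    have : ψ z = τ (Θ (φ z)) := congrFun (congrArg DFunLike.coe hψ) ⟨z, hz⟩
    rw [this, hτ]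
  let g : ℂ → Circle := fun z => if z ∈ W then Θ (φ z) else Circle.exp (ψ z)
  have hgW : EqOn g (fun z => Θ (φ z)) (closure W) := by
    intro z hz
    by_cases hzW : z ∈ W
    · exact if_pos hzW
    · exact (if_neg hzW).trans (hψ' z (hfr z hz hzW))
  have hg : Continuous g := by
    have hun : closure W ∪ Wᶜ = univ :=
      eq_univ_of_univ_subset ((union_compl_self W).symm.subset.trans
        (union_subset_union_left _ subset_closure))
    rw [← continuousOn_univ, ← hun]
    refine (hΘ.congr hgW).union_of_isClosed ?_ isClosed_closure hW.isClosed_compl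
    refine ContinuousOn.congr (f := fun z => Circle.exp (ψ z)) (by fun_prop) ?_
    intro z hz
    exact if_neg hz
  exact ⟨⟨g, hg⟩, hgW⟩

/-- The radial projection onto the unit circle. -/
noncomputable def circleProj (z : ℂ) : Circle := Circle.exp z.arg

theorem coe_circleProj {z : ℂ} (h : z ≠ 0) : (circleProj z : ℂ) = z / ‖z‖ := by
  rw [eq_div_iff (by simpa using h), mul_comm, circleProj, Circle.coe_exp,
    Complex.norm_mul_exp_arg_mul_I]

theorem circleProj_coe (t : Circle) : circleProj t = t := by
  apply Circle.ext
  rw [coe_circleProj t.coe_ne_zero, Circle.norm_coe]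
  simp

theorem isInducing_circle_coe : IsInducing (fun t : Circle => (t : ℂ)) := ⟨rfl⟩

theorem continuousAt_circleProj {z : ℂ} (h : z ≠ 0) : ContinuousAt circleProj z := by
  rw [isInducing_circle_coe.continuousAt_iff]
  have h1 : ContinuousAt (fun z : ℂ => z / (‖z‖ : ℂ)) z :=
    continuousAt_id.div (by fun_prop) (by simpa using h)
  refine h1.congr ?_
  filter_upwards [isOpen_ne.mem_nhds h] with w hw
  exact (coe_circleProj hw).symm

/-- A null homotopy of a loop extends the loop to the plane. -/
theorem exists_cone {Y : Type*} [TopologicalSpace Y] (b : C(Circle, Y)) (h : b.Nullhomotopic) :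
    ∃ H : C(ℂ, Y), ∀ z : ℂ, 1 ≤ ‖z‖ → H z = b (circleProj z) := by
  obtain ⟨c, ⟨G⟩⟩ := h
  let s : ℂ → unitInterval := fun z => projIcc 0 1 zero_le_one (1 - ‖z‖)
  have hs : Continuous s := continuous_projIcc.comp (by fun_prop)
  have hs0 : s 0 = 1 := by
    simp [s]
  let H : ℂ → Y := fun z => G (s z, circleProj z)
  have hH : Continuous H := by
    rw [continuous_iff_continuousAt]
    intro z
    by_cases hz : z = 0
    · subst hz
      intro N hN
      have hc0 : H 0 = c := by
        simp only [H, hs0]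
        exact G.apply_one _
      rw [hc0] at hN
      obtain ⟨N', hN', hN'o, hcN'⟩ := mem_nhds_iff.1 hN
      -- `circleProj` jumps at the origin, so the estimate must be uniform in the angle; compactness
      -- of the circle provides this.
      have hev : ∀ᶠ z in 𝓝 (0 : ℂ), MapsTo (G.toContinuousMap.curry (s z)) univ N' := by
        have hcont : Continuous fun z => G.toContinuousMap.curry (s z) :=
          (ContinuousMap.continuous _).comp hs
        refine hcont.continuousAt.eventually
          ((ContinuousMap.isOpen_setOfPred_mapsTo isCompact_univ hN'o).mem_nhds ?_)
        intro t _
        change G (s 0, t) ∈ N'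
        rw [hs0]
        rw [G.apply_one]
        exact hcN'
      rw [mem_map]
      filter_upwards [hev] with w hw
      exact hN' (hw (mem_univ (circleProj w)))
    · exact G.continuous.continuousAt.comp (hs.continuousAt.prodMk (continuousAt_circleProj hz))
  refine ⟨⟨H, hH⟩, fun z hz => ?_⟩
  have hsz : s z = 0 := projIcc_of_le_left zero_le_one (by linarith)
  change G (s z, circleProj z) = b (circleProj z)
  rw [hsz, G.apply_zero]

/-! ### Cylindrical coordinates and closedness of the core. -/

section Cylindrical

theorem cyl_apply_zero (r φ z : ℝ) : cyl r φ z 0 = r * Real.cos φ := rfl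

theorem cyl_apply_one (r φ z : ℝ) : cyl r φ z 1 = r * Real.sin φ := rfl

theorem continuous_cylRadius : Continuous cylRadius := by
  unfold cylRadius
  fun_prop

theorem cylRadius_nonneg (p : E3) : 0 ≤ cylRadius p := Real.sqrt_nonneg _

theorem cylRadius_cyl {r : ℝ} (hr : 0 ≤ r) (φ z : ℝ) : cylRadius (cyl r φ z) = r := by
  have : (r * Real.cos φ) ^ 2 + (r * Real.sin φ) ^ 2 = r ^ 2 := by
    linear_combination r ^ 2 * Real.sin_sq_add_cos_sq φ
  rw [cylRadius, cyl_apply_zero, cyl_apply_one, this, Real.sqrt_sq hr]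

/-- The horizontal part of a point, as a complex number. -/
def horizontal (p : E3) : ℂ := ⟨p 0, p 1⟩

theorem continuous_horizontal : Continuous horizontal := by
  have : horizontal = fun p => Complex.equivRealProdCLM.symm (p 0, p 1) := by
    funext p
    rfl
  rw [this]
  fun_prop

theorem norm_horizontal (p : E3) : ‖horizontal p‖ = cylRadius p := by
  rw [Complex.norm_def, Complex.normSq_apply, cylRadius, horizontal, pow_two, pow_two]

theorem horizontal_ne_zero {p : E3} (h : cylRadius p ≠ 0) : horizontal p ≠ 0 := by
  rwa [← norm_ne_zero_iff, norm_horizontal]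

theorem eq_cyl_arg (p : E3) : p = cyl (cylRadius p) (horizontal p).arg (p 2) := by
  rw [← norm_horizontal]
  ext i
  fin_cases i
  · exact (Complex.norm_mul_cos_arg (horizontal p)).symm
  · exact (Complex.norm_mul_sin_arg (horizontal p)).symm
  · rfl

theorem circleProj_horizontal_cyl {r : ℝ} (hr : 0 < r) (φ z : ℝ) :
    circleProj (horizontal (cyl r φ z)) = Circle.exp φ := by
  have h1 : cylRadius (cyl r φ z) = r := cylRadius_cyl hr.le φ z
  apply Circle.ext
  rw [coe_circleProj (horizontal_ne_zero (h1.trans_ne hr.ne')), norm_horizontal, h1,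
    div_eq_iff (by exact_mod_cast hr.ne'), Circle.coe_exp]
  apply Complex.ext
  · rw [Complex.re_mul_ofReal, Complex.exp_ofReal_mul_I_re, mul_comm]
    rfl
  · rw [Complex.im_mul_ofReal, Complex.exp_ofReal_mul_I_im, mul_comm]
    rfl

theorem mem_surface_iff {r₀ : ℝ} {p : E3} :
    p ∈ surface r₀ ↔ 0 < cylRadius p ∧ cylRadius p ≤ r₀ ∧ p 2 = Real.sin (1 / cylRadius p) := by
  constructor
  · rintro ⟨r, φ, h0, h1, rfl⟩
    rw [cylRadius_cyl h0.le]
    exact ⟨h0, h1, rfl⟩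
  · rintro ⟨h0, h1, h2⟩
    refine ⟨_, (horizontal p).arg, h0, h1, ?_⟩
    rw [← h2]
    exact eq_cyl_arg p

theorem mem_centralArc_iff {p : E3} :
    p ∈ centralArc ↔ cylRadius p = 0 ∧ -1 ≤ p 2 ∧ p 2 ≤ 1 := by
  constructor
  · rintro ⟨z, h0, h1, rfl⟩
    exact ⟨cylRadius_cyl le_rfl 0 z, h0, h1⟩
  · rintro ⟨h0, h1, h2⟩
    refine ⟨p 2, h1, h2, ?_⟩
    have h := eq_cyl_arg p
    rw [h0] at h
    rw [h]
    simp [cyl]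

theorem isClosed_centralArc : IsClosed centralArc := by
  have : centralArc = {p | cylRadius p = 0} ∩ ({p | -1 ≤ p 2} ∩ {p | p 2 ≤ 1}) := by
    ext p
    exact mem_centralArc_iff
  rw [this]
  exact (isClosed_eq continuous_cylRadius continuous_const).inter
    ((isClosed_le continuous_const (by fun_prop)).inter
      (isClosed_le (by fun_prop) continuous_const))

theorem continuous_mul_sin_inv : Continuous fun r : ℝ => r * Real.sin (1 / r) := by
  rw [continuous_iff_continuousAt]
  intro r
  by_cases hr : r = 0
  · subst hr
    have h : Tendsto (fun r : ℝ => r * Real.sin (1 / r)) (𝓝 0) (𝓝 0) :=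
      squeeze_zero_norm (a := fun r => |r|) (fun r => by
        rw [norm_mul, Real.norm_eq_abs, Real.norm_eq_abs]
        exact mul_le_of_le_one_right (abs_nonneg r) (Real.abs_sin_le_one _))
        (by simpa using (continuous_abs (G := ℝ)).tendsto 0)
    simpa [ContinuousAt] using h
  · exact continuousAt_id.mul (Real.continuous_sin.continuousAt.comp
      (continuousAt_const.div continuousAt_id hr))

/-- Multiplying `z = sin (1 / r)` by `r` gives a closed condition that is void at `r = 0`, where the
bounds on `z` leave exactly the central arc. -/
theorem isClosed_core {r₀ : ℝ} (hr₀ : 0 < r₀) : IsClosed (core r₀) := by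
  have : core r₀ = {p | cylRadius p ≤ r₀} ∩ ({p | -1 ≤ p 2} ∩ ({p | p 2 ≤ 1} ∩
      {p | cylRadius p * p 2 = cylRadius p * Real.sin (1 / cylRadius p)})) := by
    ext p
    simp only [core, mem_union, mem_surface_iff, mem_centralArc_iff, mem_inter_iff, mem_ofPred_eq]
    constructor
    · rintro (⟨h0, h1, h2⟩ | ⟨h0, h1, h2⟩)
      · rw [h2]
        exact ⟨h1, Real.neg_one_le_sin _, Real.sin_le_one _, rfl⟩
      · rw [h0]
        exact ⟨hr₀.le, h1, h2, by simp⟩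
    · rintro ⟨h0, h1, h2, h3⟩
      rcases (cylRadius_nonneg p).lt_or_eq with h | h
      · exact Or.inl ⟨h, h0, mul_left_cancel₀ h.ne' h3⟩
      · exact Or.inr ⟨h.symm, h1, h2⟩
  rw [this]
  have hR := continuous_cylRadius
  exact (isClosed_le hR continuous_const).inter ((isClosed_le continuous_const (by fun_prop)).inter
    ((isClosed_le (by fun_prop) continuous_const).inter
      (isClosed_eq (by fun_prop) (continuous_mul_sin_inv.comp hR))))

end Cylindrical

/-! ### Null sequences of arcs and finite cuts. -/

section Arcs

variable {r₀ : ℝ} {α : ℕ → C(unitInterval, E3)}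

/-- Off the core, a point of the connecting arcs determines its arc and its parameter. -/
theorem IsConnectingArcs.index_unique (hα : IsConnectingArcs r₀ α) {m n : ℕ} {s t : unitInterval}
    (h : α m s = α n t) (hc : α m s ∉ core r₀) : m = n ∧ s = t := by
  have hmn : m = n := by
    by_contra hne
    exact hc (hα.disjoint m n hne ⟨mem_range_self s, h ▸ mem_range_self t⟩)
  subst hmn
  exact ⟨rfl, hα.injective m h⟩

/-- Only finitely many connecting arcs meet a set at positive distance from the core. -/
theorem IsConnectingArcs.finite_meeting (hα : IsConnectingArcs r₀ α) {Z : Set E3} {d : ℝ}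
    (hd : 0 < d) (hZ : ∀ u ∈ Z, ∀ c ∈ core r₀, d ≤ dist u c) :
    {m | ∃ t, α m t ∈ Z}.Finite := by
  have hev : ∀ᶠ m in cofinite, Metric.diam (range (α m)) < d := by
    rw [Nat.cofinite_eq_atTop]
    exact hα.null.eventually (gt_mem_nhds hd)
  refine Set.Finite.subset hev ?_
  rintro m ⟨t, ht⟩ hm
  have h1 := hZ _ ht _ (hα.source_mem m)
  have h2 := Metric.dist_le_diam_of_mem (isCompact_range (α m).continuous).isBounded
    (mem_range_self t) (mem_range_self 0)
  exact absurd hm (not_lt.2 (h1.trans h2))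

/-- Off the core the arcs are locally finite, because their diameters tend to zero. Complements of
such sets serve as neighbourhoods that meet only selected pieces of arcs. -/
theorem IsConnectingArcs.isClosed_core_union (hα : IsConnectingArcs r₀ α) (hr₀ : 0 < r₀)
    {T : ℕ → Set unitInterval} (hT : ∀ m, IsClosed (T m)) :
    IsClosed (core r₀ ∪ ⋃ m, α m '' T m) := by
  rw [← isOpen_compl_iff, isOpen_iff_mem_nhds]
  intro u hu
  have huc : u ∉ core r₀ := fun h => hu (Or.inl h)
  obtain ⟨d, hd, hball⟩ := Metric.isOpen_iff.1 (isClosed_core hr₀).isOpen_compl u huc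
  have hfin := hα.finite_meeting (Z := Metric.ball u (d / 2)) (half_pos hd) (by
    intro v hv c hc
    by_contra! hlt
    refine hball ?_ hc
    have h1 := dist_triangle c v u
    rw [Metric.mem_ball] at hv ⊢
    rw [dist_comm c v] at h1
    linarith)
  have hcl : IsClosed (⋃ m ∈ {m | ∃ t, α m t ∈ Metric.ball u (d / 2)}, α m '' T m) :=
    hfin.isClosed_biUnion fun m _ => ((hT m).isCompact.image (α m).continuous).isClosed
  have hu' : u ∉ ⋃ m ∈ {m | ∃ t, α m t ∈ Metric.ball u (d / 2)}, α m '' T m := by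
    intro h
    obtain ⟨m, -, hm⟩ := mem_iUnion₂.1 h
    exact hu (Or.inr (mem_iUnion.2 ⟨m, hm⟩))
  filter_upwards [Metric.ball_mem_nhds u (half_pos hd), Metric.ball_mem_nhds u hd,
    hcl.isOpen_compl.mem_nhds hu'] with v hv hv' hvT
  rintro (h | h)
  · exact hball hv' h
  · obtain ⟨m, t, ht, rfl⟩ := mem_iUnion.1 h
    exact hvT (mem_iUnion₂.2 ⟨m, ⟨t, hv⟩, t, ht, rfl⟩)

/-- A compact subset of an open set of parameters has a neighbourhood with finite frontier. -/
theorem exists_open_finite_frontier {T O : Set unitInterval} (hT : IsCompact T) (hO : IsOpen O)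
    (hTO : T ⊆ O) : ∃ V, IsOpen V ∧ T ⊆ V ∧ closure V ⊆ O ∧ (frontier V).Finite := by
  refine hT.induction_on (p := fun T => ∃ V, IsOpen V ∧ T ⊆ V ∧ closure V ⊆ O ∧
    (frontier V).Finite) ?_ ?_ ?_ ?_
  · exact ⟨∅, isOpen_empty, Subset.rfl, by simp, by simp⟩
  · rintro s t hst ⟨V, h1, h2, h3⟩
    exact ⟨V, h1, hst.trans h2, h3⟩
  · rintro s t ⟨V, h1, h2, h3, h4⟩ ⟨V', h1', h2', h3', h4'⟩
    refine ⟨V ∪ V', h1.union h1', union_subset_union h2 h2', ?_, ?_⟩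
    · rw [closure_union]
      exact union_subset h3 h3'
    · exact (h4.union h4').subset ((frontier_union_subset V V').trans
        (union_subset_union inter_subset_left inter_subset_right))
  · intro t ht
    obtain ⟨d, hd, hball⟩ := Metric.nhds_basis_closedBall.mem_iff.1 (hO.mem_nhds (hTO ht))
    refine ⟨Metric.ball t d, mem_nhdsWithin_of_mem_nhds (Metric.ball_mem_nhds t hd),
      Metric.ball t d, Metric.isOpen_ball, Subset.rfl,
      Metric.closure_ball_subset_closedBall.trans hball, ?_⟩
    refine Set.Finite.subset ?_ Metric.frontier_ball_subset_sphere
    refine Set.Finite.of_injOn (f := Subtype.val) (t := {(t : ℝ) + d, (t : ℝ) - d}) ?_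
      Subtype.val_injective.injOn (by simp)
    intro s hs
    rw [Metric.mem_sphere, Subtype.dist_eq, Real.dist_eq] at hs
    rcases abs_choice ((s : ℝ) - t) with h | h <;> rw [h] at hs
    · left; linarith
    · right; rw [mem_singleton_iff]; linarith

/-- Compact pieces of finitely many connecting arcs, lying off the core, can be enclosed in
subsets of the arcs that are cut off by finitely many points. -/
theorem IsConnectingArcs.exists_cut (hα : IsConnectingArcs r₀ α) (hr₀ : 0 < r₀)
    {T : ℕ → Set unitInterval} (hT : ∀ m, IsCompact (T m)) (hTc : ∀ m, ∀ t ∈ T m, α m t ∉ core r₀)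
    (hfin : {m | (T m).Nonempty}.Finite) :
    ∃ F C N : Set E3, F.Finite ∧ IsClosed C ∧ IsOpen N ∧ Disjoint F (core r₀) ∧
      Disjoint C (core r₀) ∧ Disjoint N F ∧ spaceA r₀ α ∩ N ⊆ C ∧ C ⊆ F ∪ N ∧
      ∀ m, ∀ t ∈ T m, α m t ∈ N := by
  -- The last clause keeps `V` empty on arcs without a piece to enclose, so that the unions below
  -- are finite.
  have hex : ∀ m, ∃ V, IsOpen V ∧ T m ⊆ V ∧ (∀ t ∈ closure V, α m t ∉ core r₀) ∧
      (frontier V).Finite ∧ (V.Nonempty → (T m).Nonempty) := by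
    intro m
    rcases (T m).eq_empty_or_nonempty with h | h
    · exact ⟨∅, isOpen_empty, h.subset, by simp, by simp, by simp⟩
    · obtain ⟨V, h1, h2, h3, h4⟩ := exists_open_finite_frontier (hT m)
        ((isClosed_core hr₀).isOpen_compl.preimage (α m).continuous) (hTc m)
      exact ⟨V, h1, h2, fun t ht => h3 ht, h4, fun _ => h⟩
  choose V hVo hTV hVc hVf hVT using hex
  have hcl : ∀ m t, t ∈ closure (V m) → m ∈ {m | (T m).Nonempty} := fun m t ht =>
    hVT m (closure_nonempty_iff.1 ⟨t, ht⟩)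
  have hN : ∀ m, ∀ t ∈ V m, α m t ∉ core r₀ ∪ ⋃ m, α m '' (V m)ᶜ := by
    intro m t ht
    have hc := hVc m t (subset_closure ht)
    rintro (h | h)
    · exact hc h
    · obtain ⟨n, s, hs, h⟩ := mem_iUnion.1 h
      obtain ⟨rfl, rfl⟩ := hα.index_unique h (h ▸ hc)
      exact hs ht
  -- `F` and `C` are the images of the frontiers and closures of the `V m`; `N` removes the core and
  -- all parts of arcs outside the `V m`.
  refine ⟨⋃ m ∈ {m | (T m).Nonempty}, α m '' frontier (V m),
    ⋃ m ∈ {m | (T m).Nonempty}, α m '' closure (V m), (core r₀ ∪ ⋃ m, α m '' (V m)ᶜ)ᶜ,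
    hfin.biUnion fun m _ => (hVf m).image _,
    hfin.isClosed_biUnion fun m _ => (isClosed_closure.isCompact.image (α m).continuous).isClosed,
    (hα.isClosed_core_union hr₀ fun m => (hVo m).isClosed_compl).isOpen_compl, ?_, ?_, ?_, ?_, ?_,
    ?_⟩
  · rw [Set.disjoint_left]
    intro v hv
    obtain ⟨m, -, t, ht, rfl⟩ := mem_iUnion₂.1 hv
    exact hVc m t (frontier_subset_closure ht)
  · rw [Set.disjoint_left]
    intro v hv
    obtain ⟨m, -, t, ht, rfl⟩ := mem_iUnion₂.1 hv
    exact hVc m t ht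
  · rw [Set.disjoint_right]
    intro v hv hvN
    obtain ⟨m, -, t, ht, rfl⟩ := mem_iUnion₂.1 hv
    rw [(hVo m).frontier_eq] at ht
    exact hvN (Or.inr (mem_iUnion.2 ⟨m, t, ht.2, rfl⟩))
  · rintro v ⟨hvA | hvA, hvN⟩
    · exact absurd (Or.inl hvA) hvN
    · obtain ⟨m, t, rfl⟩ := mem_iUnion.1 hvA
      have ht : t ∈ V m := by
        by_contra ht
        exact hvN (Or.inr (mem_iUnion.2 ⟨m, t, ht, rfl⟩))
      have := subset_closure ht
      exact mem_iUnion₂.2 ⟨m, hcl m t this, t, this, rfl⟩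
  · intro v hv
    obtain ⟨m, hm, t, ht, rfl⟩ := mem_iUnion₂.1 hv
    by_cases htV : t ∈ V m
    · exact Or.inr (hN m t htV)
    · exact Or.inl (mem_iUnion₂.2 ⟨m, hm, t, by rw [(hVo m).frontier_eq]; exact ⟨ht, htV⟩, rfl⟩)
  · exact fun m t ht => hN m t (hTV m ht)

/-! ### Local separation near the central arc, and the angle away from it. -/

theorem exists_small_sin_inv_eq {R : ℝ} (hR : 0 < R) {w : ℝ} (hw : w = 1 ∨ w = -1) :
    ∃ r, 0 < r ∧ r < R ∧ Real.sin (1 / r) = w := by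
  obtain ⟨n, hn⟩ := exists_nat_gt (1 / R + 1)
  have hπ := Real.pi_gt_three
  have hR' : 0 < 1 / R := by positivity
  have key : ∀ a : ℝ, -(Real.pi / 2) ≤ a → Real.sin a = w →
      ∃ r, 0 < r ∧ r < R ∧ Real.sin (1 / r) = w := by
    intro a ha hsin
    have hbig : 1 / R < a + n * (2 * Real.pi) := by nlinarith
    refine ⟨1 / (a + n * (2 * Real.pi)), one_div_pos.2 (hR'.trans hbig), ?_, ?_⟩
    · rw [div_lt_comm₀ (hR'.trans hbig) hR]
      exact hbig
    · rw [one_div_one_div, Real.sin_add_nat_mul_two_pi, hsin]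
  rcases hw with rfl | rfl
  · exact key (Real.pi / 2) (by linarith) Real.sin_pi_div_two
  · exact key (-(Real.pi / 2)) le_rfl (by rw [Real.sin_neg, Real.sin_pi_div_two])

/-- Inside a ball of radius `1 / 2` about a point `p` of the central arc, finitely many points of
the connecting arcs separate `p` from a given point off the central arc. -/
theorem IsConnectingArcs.exists_local_cut (hα : IsConnectingArcs r₀ α) (hr₀ : 0 < r₀) {p q : E3}
    (hp : p ∈ centralArc) (hq : q ∈ spaceA r₀ α) (hqL : q ∉ centralArc) :
    ∃ F O₁ O₂ : Set E3, F.Finite ∧ Disjoint F (core r₀) ∧ q ∉ F ∧ IsOpen O₁ ∧ IsOpen O₂ ∧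
      p ∈ O₁ ∧ q ∈ O₂ ∧ (∀ v ∈ spaceA r₀ α, v ∈ O₁ → v ∉ O₂) ∧
      ∀ v ∈ spaceA r₀ α, dist v p ≤ 1 / 2 → v ∈ F ∪ (O₁ ∪ O₂) := by
  have hpc : p ∈ core r₀ := Or.inr hp
  obtain ⟨hpR, hp1, hp2⟩ := mem_centralArc_iff.1 hp
  by_cases hqc : q ∈ core r₀
  · obtain ⟨hqR, -, -⟩ := mem_surface_iff.1 (hqc.resolve_right hqL)
    -- One of the extreme heights is at distance at least `1` from `p`, so where the surface has
    -- that height it is outside the ball of radius `1 / 2`.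
    obtain ⟨w, hw, hwp⟩ : ∃ w : ℝ, (w = 1 ∨ w = -1) ∧ 1 ≤ |w - p 2| := by
      rcases le_total (p 2) 0 with h | h
      · exact ⟨1, Or.inl rfl, by rw [abs_of_nonneg] <;> linarith⟩
      · exact ⟨-1, Or.inr rfl, by rw [abs_of_nonpos] <;> linarith⟩
    obtain ⟨r, hr, hrq, hrw⟩ := exists_small_sin_inv_eq hqR hw
    let Z : Set E3 := Metric.closedBall p (1 / 2) ∩ {v | cylRadius v = r}
    have hZ : IsCompact Z := (isCompact_closedBall p (1 / 2)).inter_right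
      (isClosed_eq continuous_cylRadius continuous_const)
    have hZc : ∀ v ∈ Z, v ∉ core r₀ := by
      rintro v ⟨hvp, hvr : cylRadius v = r⟩ (hv | hv)
      · have h2 : v 2 = w := by rw [(mem_surface_iff.1 hv).2.2, hvr, hrw]
        have h3 : |v 2 - p 2| ≤ dist v p := by
          have := PiLp.norm_apply_le (v - p) 2
          rwa [← dist_eq_norm] at this
        rw [Metric.mem_closedBall] at hvp
        rw [h2] at h3
        linarith
      · rw [(mem_centralArc_iff.1 hv).1] at hvr
        exact hr.ne hvr
    obtain ⟨d, hd, hdZ⟩ := Metric.exists_pos_forall_lt_edist hZ (isClosed_core hr₀)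
      (Set.disjoint_left.2 hZc)
    have hfin := hα.finite_meeting (Z := Z) (d := d) (by exact_mod_cast hd) (by
      intro u hu c hc
      have := hdZ u hu c hc
      rw [edist_nndist, ENNReal.coe_lt_coe] at this
      exact_mod_cast this.le)
    obtain ⟨F, C, N, hF, hC, hN, hFc, hCc, hNF, hNC, hCFN, hTN⟩ := hα.exists_cut hr₀
      (T := fun m => α m ⁻¹' Z) (fun m => (hZ.isClosed.preimage (α m).continuous).isCompact)
      (fun m t ht => hZc _ ht) hfin
    -- The sides are the inside and outside of the cylinder of radius `r`, with the enclosed arc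
    -- pieces that cross it assigned to the inside.
    refine ⟨F, ({v | cylRadius v < r} \ C) ∪ N, {v | r < cylRadius v} \ C, hF, hFc,
      fun h => hFc.le_bot ⟨h, hqc⟩,
      ((isOpen_lt continuous_cylRadius continuous_const).sdiff hC).union hN,
      (isOpen_lt continuous_const continuous_cylRadius).sdiff hC,
      Or.inl ⟨hpR.trans_lt hr, fun h => hCc.le_bot ⟨h, hpc⟩⟩,
      ⟨hrq, fun h => hCc.le_bot ⟨h, hqc⟩⟩, ?_, ?_⟩
    · rintro v hvA (⟨h1 : cylRadius v < r, -⟩ | h1) ⟨h2 : r < cylRadius v, h3⟩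
      · exact lt_asymm h1 h2
      · exact h3 (hNC ⟨hvA, h1⟩)
    · intro v hvA hvp
      by_cases hvC : v ∈ C
      · exact (hCFN hvC).imp id fun h => Or.inl (Or.inr h)
      · rcases lt_trichotomy (cylRadius v) r with h | h | h
        · exact Or.inr (Or.inl (Or.inl ⟨h, hvC⟩))
        · have hvZ : v ∈ Z := ⟨hvp, h⟩
          obtain ⟨m, t, rfl⟩ := mem_iUnion.1 (hvA.resolve_left (hZc v hvZ))
          exact Or.inr (Or.inl (Or.inr (hTN m t hvZ)))
        · exact Or.inr (Or.inr ⟨h, hvC⟩)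
  · obtain ⟨n, t, rfl⟩ := mem_iUnion.1 (hq.resolve_left hqc)
    -- Here `q` lies on an arc off the core, and a small piece of that arc around `q` is cut off.
    obtain ⟨F, C, N, hF, hC, hN, hFc, hCc, hNF, hNC, hCFN, hTN⟩ := hα.exists_cut hr₀
      (T := fun m => {s | m = n ∧ s = t})
      (fun m => ((finite_singleton t).subset fun s hs => hs.2).isCompact)
      (by rintro m s ⟨rfl, rfl⟩; exact hqc)
      ((finite_singleton n).subset fun m ⟨s, hs⟩ => hs.1)
    have htN := hTN n t ⟨rfl, rfl⟩
    refine ⟨F, Cᶜ, N, hF, hFc, fun h => hNF.le_bot ⟨htN, h⟩, hC.isOpen_compl, hN,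
      fun h => hCc.le_bot ⟨h, hpc⟩, htN, fun v hvA h1 h2 => h1 (hNC ⟨hvA, h2⟩), ?_⟩
    intro v hvA _
    by_cases hvC : v ∈ C
    · exact (hCFN hvC).imp id Or.inr
    · exact Or.inr (Or.inl hvC)

/-- The angular coordinate extends continuously to all of the space `A` without the central arc. -/
theorem IsConnectingArcs.exists_angle (hα : IsConnectingArcs r₀ α) (hr₀ : 0 < r₀) :
    ∃ Θ : E3 → Circle, ContinuousOn Θ (spaceA r₀ α \ centralArc) ∧
      ∀ r φ z, 0 < r → Θ (cyl r φ z) = Circle.exp φ := by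
  classical
  choose φ hφ using hα.radial
  -- An arc may cross the axis beyond the central arc, where there is no polar angle; the angle of
  -- its half-plane is used there. The value `1` is a dummy off `A`.
  let Θ : E3 → Circle := fun p => if cylRadius p ≠ 0 then circleProj (horizontal p) else
    if h : ∃ n, p ∈ range (α n) then Circle.exp (φ h.choose) else 1
  have hΘ : ∀ r φ z, 0 < r → Θ (cyl r φ z) = Circle.exp φ := by
    intro r φ z hr
    have h1 : cylRadius (cyl r φ z) ≠ 0 := (cylRadius_cyl hr.le φ z).trans_ne hr.ne'
    exact (if_pos h1).trans (circleProj_horizontal_cyl hr φ z)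
  refine ⟨Θ, ?_, hΘ⟩
  rintro u ⟨huA, huL⟩
  by_cases hu : cylRadius u ≠ 0
  · have h1 : ContinuousAt (fun p => circleProj (horizontal p)) u :=
      (continuousAt_circleProj (horizontal_ne_zero hu)).comp continuous_horizontal.continuousAt
    refine (h1.congr ?_).continuousWithinAt
    filter_upwards [(isOpen_ne_fun continuous_cylRadius continuous_const).mem_nhds hu] with v hv
    exact (if_pos hv).symm
  · rw [not_not] at hu
    have huc : u ∉ core r₀ := by
      rintro (h | h)
      · exact (mem_surface_iff.1 h).1.ne' hu
      · exact huL h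
    obtain ⟨n, t, rfl⟩ := mem_iUnion.1 (huA.resolve_left huc)
    have hcl := hα.isClosed_core_union hr₀ (T := fun m => {_s | m ≠ n}) fun m => isClosed_const
    have hconst : ∀ v ∈ spaceA r₀ α, v ∉ core r₀ ∪ ⋃ m, α m '' {_s | m ≠ n} →
        Θ v = Circle.exp (φ n) := by
      intro v hvA hv
      have hvc : v ∉ core r₀ := fun h => hv (Or.inl h)
      obtain ⟨m, s, rfl⟩ := mem_iUnion.1 (hvA.resolve_left hvc)
      have hmn : m = n := by
        by_contra hmn
        exact hv (Or.inr (mem_iUnion.2 ⟨m, s, hmn, rfl⟩))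
      subst hmn
      by_cases hvR : cylRadius (α m s) ≠ 0
      · obtain ⟨r, z, hr, h⟩ := hφ m (mem_range_self s)
        rw [h] at hvR ⊢
        rw [cylRadius_cyl hr] at hvR
        exact hΘ r (φ m) z (lt_of_le_of_ne hr hvR.symm)
      · have hex : ∃ n, α m s ∈ range (α n) := ⟨m, mem_range_self s⟩
        have hch : hex.choose = m := by
          obtain ⟨s', hs'⟩ := hex.choose_spec
          exact ((hα.index_unique hs'.symm hvc).1).symm
        simp only [Θ, if_neg hvR, dif_pos hex, hch]
    have hun : α n t ∉ core r₀ ∪ ⋃ m, α m '' {_s | m ≠ n} := by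
      rintro (h | h)
      · exact huc h
      · obtain ⟨m, s, hs, h⟩ := mem_iUnion.1 h
        exact hs (hα.index_unique h (h ▸ huc)).1
    refine (continuousWithinAt_const (b := Circle.exp (φ n))).congr_of_eventuallyEq ?_
      (hconst _ huA hun)
    filter_upwards [self_mem_nhdsWithin, mem_nhdsWithin_of_mem_nhds
      (hcl.isOpen_compl.mem_nhds hun)] with v hvA hv
    exact hconst v hvA.1 hv

end Arcs

/-! ### Separating the unit circle from the preimage of the central arc. -/

section Separation

variable {r₀ : ℝ} {α : ℕ → C(unitInterval, E3)}

/-- A map from the plane to `A` that carries everything outside the unit disc to the surface: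
finitely many points of the connecting arcs have a preimage separating the unit circle from the
preimage of the central arc. -/
theorem IsConnectingArcs.exists_separating_preimage (hα : IsConnectingArcs r₀ α) (hr₀ : 0 < r₀)
    (H : C(ℂ, E3)) (hHA : ∀ z, H z ∈ spaceA r₀ α) (hHS : ∀ z, 1 ≤ ‖z‖ → H z ∈ surface r₀) :
    ∃ F : Set E3, F.Finite ∧ Disjoint F (core r₀) ∧
      ∀ z ∈ closure (connectedComponentIn (H ⁻¹' F)ᶜ 1), H z ∉ centralArc := by
  by_contra! hcon
  let ι := {F : Set E3 // F.Finite ∧ Disjoint F (core r₀)}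
  have : Nonempty ι := ⟨⟨∅, finite_empty, empty_disjoint _⟩⟩
  let W : Set E3 → Set ℂ := fun F => connectedComponentIn (H ⁻¹' F)ᶜ 1
  let M : ι → Set ℂ := fun F => closure (W F.1) ∩ Metric.closedBall 0 1
  have hWmono : ∀ F G : Set E3, F ⊆ G → W G ⊆ W F := fun F G h =>
    connectedComponentIn_mono 1 (compl_subset_compl.2 (preimage_mono h))
  have hsphere : ∀ F : ι, Metric.sphere (0 : ℂ) 1 ⊆ W F.1 := by
    intro F
    refine (isPreconnected_sphere (by simp) (0 : ℂ) 1).subset_connectedComponentIn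
      (by simp) ?_
    intro z hz hzF
    exact F.2.2.le_bot ⟨hzF, Or.inl (hHS z (mem_sphere_zero_iff_norm.1 hz).ge)⟩
  have hdir : Directed (· ⊇ ·) M := by
    intro F G
    refine ⟨⟨F.1 ∪ G.1, F.2.1.union G.2.1, F.2.2.union_left G.2.2⟩, ?_, ?_⟩
    · exact inter_subset_inter_left _ (closure_mono (hWmono _ _ subset_union_left))
    · exact inter_subset_inter_left _ (closure_mono (hWmono _ _ subset_union_right))
  have hMc : ∀ F, IsCompact (M F) := fun F =>
    (isCompact_closedBall 0 1).inter_left isClosed_closure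
  have hMp : ∀ F, IsPreconnected (M F) := by
    intro F
    -- Radial retraction onto the disc keeps the closure of `W F` within itself, since the unit
    -- circle lies in `W F`; hence `M F` is a connected image.
    have himg : M F = (fun z : ℂ => z / (max 1 ‖z‖ : ℝ)) '' closure (W F.1) := by
      ext z
      constructor
      · rintro ⟨hz, hz1⟩
        rw [mem_closedBall_zero_iff] at hz1
        exact ⟨z, hz, by simp [max_eq_left hz1]⟩
      · rintro ⟨z, hz, rfl⟩
        rcases le_total ‖z‖ 1 with h | h
        · simp only [max_eq_left h, Complex.ofReal_one, div_one]
          exact ⟨hz, mem_closedBall_zero_iff.2 h⟩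
        · simp only [max_eq_right h]
          have : z / (‖z‖ : ℂ) ∈ Metric.sphere (0 : ℂ) 1 := by
            rw [mem_sphere_zero_iff_norm, norm_div, Complex.norm_real, norm_norm,
              div_self (by linarith)]
          exact ⟨subset_closure (hsphere F this), Metric.sphere_subset_closedBall this⟩
    rw [himg]
    refine isPreconnected_connectedComponentIn.closure.image _ (Continuous.continuousOn ?_)
    refine continuous_id.div (by fun_prop) fun z => ?_
    exact_mod_cast (lt_of_lt_of_le one_pos (le_max_left 1 ‖z‖)).ne'
  have hone : (1 : ℂ) ∈ Metric.sphere (0 : ℂ) 1 := by simp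
  have hnot : ∀ z, 1 ≤ ‖z‖ → H z ∉ centralArc := fun z hz h =>
    (mem_surface_iff.1 (hHS z hz)).1.ne' (mem_centralArc_iff.1 h).1
  obtain ⟨x, hxL, hxM, hxcl⟩ := exists_mem_closure_diff_of_directed hdir hMc hMp
    (isClosed_centralArc.preimage H.continuous) (fun F => by
      obtain ⟨z, hz, hzL⟩ := hcon F.1 F.2.1 F.2.2
      refine ⟨z, ⟨hz, mem_closedBall_zero_iff.2 ?_⟩, hzL⟩
      by_contra h
      exact hnot z (not_le.1 h).le hzL)
    (a := 1) (fun F => ⟨subset_closure (hsphere F hone), Metric.sphere_subset_closedBall hone⟩)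
    (hnot 1 (by simp))
  obtain ⟨δ, hδ, hball⟩ := Metric.continuousAt_iff.1 (H.continuous.continuousAt (x := x))
    (1 / 4) (by norm_num)
  obtain ⟨y, ⟨hyM, hyL⟩, hyx⟩ := Metric.mem_closure_iff.1 hxcl δ hδ
  rw [mem_iInter] at hyM
  rw [dist_comm] at hyx
  obtain ⟨F, O₁, O₂, hF, hFc, hyF, hO₁, hO₂, hxO, hyO, hO, hcov⟩ :=
    hα.exists_local_cut hr₀ hxL (hHA y) hyL
  -- Splitting the cut by distance: the near part fails to separate `x` from `y`, as both lie in `W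
  -- F'`; the far part, together with everything beyond `1 / 2` where the cut gives no control,
  -- misses the `δ`-ball around `x`, which contains `y`.
  let F' := F ∩ Metric.closedBall (H x) (1 / 4)
  have hF' : F'.Finite := hF.subset inter_subset_left
  have hF'c : Disjoint F' (core r₀) := hFc.mono_left inter_subset_left
  have hmem : ∀ z, z ∈ M ⟨F', hF', hF'c⟩ → H z ∉ F' → z ∈ W F' := fun z hz hzF =>
    closure_connectedComponentIn_inter (hF'.isClosed.preimage H.continuous).isOpen_compl hz.1 hzF
  refine not_separated_union (C₁ := H ⁻¹' F')
    (C₂ := H ⁻¹' (F \ Metric.closedBall (H x) (1 / 4)) ∪ {z | 1 / 2 ≤ dist (H z) (H x)})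
    (U := H ⁻¹' O₁) (V := H ⁻¹' O₂) (Y₁ := W F') (Y₂ := Metric.ball x δ)
    (hF'.isClosed.preimage H.continuous)
    (((hF.subset sdiff_subset).isClosed.preimage H.continuous).union
      (isClosed_le continuous_const (by fun_prop)))
    ?_ (hO₁.preimage H.continuous) (hO₂.preimage H.continuous)
    (fun z h1 h2 => (hO _ (hHA z) h1 h2).elim) ?_
    isPreconnected_connectedComponentIn (convex_ball x δ).isPreconnected ?_ ?_
    (hmem x (hxM _) fun h => hF'c.le_bot ⟨h, Or.inr hxL⟩) (Metric.mem_ball_self hδ)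
    (hmem y (hyM _) fun h => hyF h.1) hyx hxO hyO
  · rw [Set.disjoint_left]
    rintro z ⟨-, hz⟩ (⟨-, hz'⟩ | hz')
    · exact hz' hz
    · rw [Metric.mem_closedBall] at hz
      change 1 / 2 ≤ dist (H z) (H x) at hz'
      linarith
  · intro z hz
    have h1 : dist (H z) (H x) ≤ 1 / 2 := by
      by_contra! h
      exact hz (Or.inr (Or.inr h.le))
    rcases hcov _ (hHA z) h1 with h | h
    · by_cases h2 : H z ∈ Metric.closedBall (H x) (1 / 4)
      · exact (hz (Or.inl ⟨h, h2⟩)).elim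
      · exact (hz (Or.inr (Or.inl ⟨h, h2⟩))).elim
    · exact h
  · rw [Set.disjoint_left]
    exact fun z hz => connectedComponentIn_subset _ _ hz
  · rw [Set.disjoint_left]
    intro z hz
    have h1 := hball hz
    rintro (⟨-, h2⟩ | h2)
    · exact h2 h1.le
    · change 1 / 2 ≤ dist (H z) (H x) at h2
      linarith

/-- A loop of constant radius that is freely nulhomotopic in `A` has a continuous real-valued
angle. -/
theorem IsConnectingArcs.exists_angle_lift (hα : IsConnectingArcs r₀ α) (hr₀ : 0 < r₀)
    (b : C(Circle, E3)) (hb : ∀ t, b t ∈ surface r₀) {ρ : ℝ} (hρ : ∀ t, cylRadius (b t) = ρ)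
    (hnul : FreelyNulhomotopicIn b (spaceA r₀ α)) :
    ∃ θ : C(Circle, ℝ), ∀ t, b t = cyl ρ (θ t) (Real.sin (1 / ρ)) := by
  obtain ⟨hbA, hnull⟩ := hnul
  obtain ⟨H', hH'⟩ := exists_cone _ hnull
  let H : C(ℂ, E3) := ⟨fun z => H' z, continuous_subtype_val.comp H'.continuous⟩
  have hHb : ∀ z, 1 ≤ ‖z‖ → H z = b (circleProj z) := fun z hz => congrArg Subtype.val (hH' z hz)
  have hHA : ∀ z, H z ∈ spaceA r₀ α := fun z => (H' z).2
  obtain ⟨F, hF, hFc, hFL⟩ := hα.exists_separating_preimage hr₀ H hHA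
    fun z hz => hHb z hz ▸ hb _
  obtain ⟨Θ, hΘc, hΘ⟩ := hα.exists_angle hr₀
  have hO : IsOpen (H ⁻¹' F)ᶜ := (hF.isClosed.preimage H.continuous).isOpen_compl
  obtain ⟨g, hg⟩ := exists_circle_extension H.continuous hF (fun z hz hzW => by
      by_contra hzF
      exact hzW (closure_connectedComponentIn_inter hO hz hzF)) Θ
    (hΘc.comp H.continuous.continuousOn fun z hz => ⟨hHA z, hFL z hz⟩) hO.connectedComponentIn
  obtain ⟨h, hh⟩ := exists_circle_lift g
  refine ⟨⟨fun t => h t, h.continuous.comp isInducing_circle_coe.continuous⟩, fun t => ?_⟩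
  have hsphere : Metric.sphere (0 : ℂ) 1 ⊆ connectedComponentIn (H ⁻¹' F)ᶜ 1 := by
    refine (isPreconnected_sphere (by simp) (0 : ℂ) 1).subset_connectedComponentIn (by simp) ?_
    intro z hz hzF
    have := hHb z (mem_sphere_zero_iff_norm.1 hz).ge
    exact hFc.le_bot ⟨hzF, Or.inl (this ▸ hb _)⟩
  have ht : Circle.exp (h t) = Θ (b t) := by
    rw [hh, hg _ (subset_closure (hsphere (mem_sphere_zero_iff_norm.2 t.norm_coe))),
      hHb t t.norm_coe.ge, circleProj_coe]
  obtain ⟨r, φ, hr, -, hbt⟩ := hb t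
  have hrρ : r = ρ := by rw [← hρ t, hbt, cylRadius_cyl hr.le]
  subst hrρ
  rw [hbt, hΘ r φ _ hr, Circle.exp_eq_exp] at ht
  obtain ⟨m, hm⟩ := ht
  rw [hbt]
  change _ = cyl r (h t) _
  rw [hm]
  simp only [cyl, Real.cos_add_int_mul_two_pi, Real.sin_add_int_mul_two_pi]

end Separation

/-! ### Contraction along the real-valued angle. -/

theorem continuous_cyl {X : Type*} [TopologicalSpace X] {f : X → ℝ} (hf : Continuous f) (r z : ℝ) :
    Continuous fun x => cyl r (f x) z := by
  unfold cyl
  fun_prop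

/-- A loop on a horizontal circle with a continuous real-valued angle contracts in its image. -/
theorem nulhomotopicIn_range_of_angle (b : C(Circle, E3)) (ρ z : ℝ) (θ : C(Circle, ℝ))
    (hθ : ∀ t, b t = cyl ρ (θ t) z) : NulhomotopicIn b (range b) := by
  refine ⟨mem_range_self, ⟨?_⟩⟩
  -- The values of `θ` form an interval, so every interpolated angle is attained and the homotopy
  -- stays in the image of `b`.
  have hconv : Convex ℝ (range θ) := (isPreconnected_range θ.continuous).ordConnected.convex
  have hmem : ∀ (s : unitInterval) (t : Circle),
      cyl ρ ((1 - (s : ℝ)) * θ t + s * θ 1) z ∈ range b := by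
    intro s t
    obtain ⟨u, hu⟩ := hconv (mem_range_self t) (mem_range_self 1) (sub_nonneg.2 s.2.2) s.2.1
      (sub_add_cancel _ _)
    refine ⟨u, ?_⟩
    rw [hθ, hu, smul_eq_mul, smul_eq_mul]
  exact
    { toFun := fun x => ⟨cyl ρ ((1 - (x.1 : ℝ)) * θ x.2 + x.1 * θ 1) z, hmem x.1 x.2⟩
      continuous_toFun := (continuous_cyl (by fun_prop) ρ z).subtype_mk _
      map_zero_left := fun t => Subtype.ext (by simp [loopIn, hθ])
      map_one_left := fun t => Subtype.ext (by simp [loopIn, hθ])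
      prop' := by
        rintro s t rfl
        refine Subtype.ext ?_
        simp [loopIn, hθ]
        ring_nf }

theorem mainTheorem6 (r₀ : ℝ) (hr₀ : 0 < r₀)
    (α : ℕ → C(unitInterval, E3)) (hα : IsConnectingArcs r₀ α)
    (b : C(Circle, E3)) (hb : ∀ t, b t ∈ surface r₀)
    (hconst : ∃ ρ : ℝ, ∀ t, cylRadius (b t) = ρ)
    (hnul : FreelyNulhomotopicIn b (spaceA r₀ α)) :
    NulhomotopicIn b (Set.range b) := by
  obtain ⟨ρ, hρ⟩ := hconst
  obtain ⟨θ, hθ⟩ := hα.exists_angle_lift hr₀ b hb hρ hnul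
  exact nulhomotopicIn_range_of_angle b ρ _ θ hθ
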